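/- Let $n\ge 1$, and let $L(\tau,\xi)$ be a polynomial with complex coefficients in the $1+n$ variables $\tau,\xi_1,\dots,\xi_n$, of total degree $m$. Assume that $L$ is strictly hyperbolic: for every $\xi\in\mathbb R^n\setminus\{0\}$ the $m$-homogeneous part $L_m(\tau,\xi)$ of $L$, seen as a polynomial in $\tau$, is not the zero polynomial and has $m$ distinct real roots. For $\xi\in\mathbb R^n$ the characteristic roots $\tau_1(\xi),\dots,\tau_m(\xi)\in\mathbb C$ are the roots of $L(\cdot,\xi)$, listed with multiplicity. A full asymptotic expansion of the characteristic roots consists of a labelling $\varphi_1(\eta),\dots,\varphi_m(\eta)$ of the roots of $L_m(\cdot,\eta)$ for each $\eta\in\mathbb S^{n-1}$, a labelling $\tau_1(\xi),\dots,\tau_m(\xi)$ of the characteristic roots for each $\xi\in\mathbb R^n$, and functions $\tau_j^{(k)}:\mathbb S^{n-1}\to\mathbb C$ ($1\le j\le m$, $k\ge 0$) such that $$\tau_j(\xi)\sim|\xi|\,\varphi_j(\eta)+\tau_j^{(0)}(\eta)+|\xi|^{-1}\tau_j^{(1)}(\eta)+\cdots,\qquad |\xi|\to\infty,\quad \eta=\xi/|\xi|,$$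 uniformly in $\eta\in\mathbb S^{n-1}$; that is, for all $j$ and all $K\ge 0$, $$\tau_j(\xi)-|\xi|\,\varphi_j(\eta)-\sum_{k=0}^{K-1}|\xi|^{-k}\tau_j^{(k)}(\eta)=O(|\xi|^{-K})\qquad\text{as }|\xi|\to\infty,\text{ uniformly in }\eta .$$ Suppose that the polynomial $L-L_m$ is of degree $d<m-1$ (where $d=-\infty$ if $L=L_m$). Then such an expansion exists, with smooth functions $\varphi_j$ and with smooth and algebraic functions $\tau_j^{(k)}$ on $\mathbb S^{n-1}$, and in every such expansion the coefficient functions $\tau_j^{(0)},\dots,\tau_j^{(m-d-2)}$ vanish identically on $\mathbb S^{n-1}$ for all $j=1,\dots,m$ (if $d=-\infty$, all $\tau_j^{(k)}$ vanish identically). Here $f:\mathbb S^{n-1}\to\mathbb C$ is algebraic if there is a polynomial $Q(z,\eta)$ with complex coefficients such that for every $\eta\in\mathbb S^{n-1}$ the polynomial $Q(\cdot,\eta)$ is nonzero and has $f(\eta)$ as a root. -/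

import Mathlib

open scoped Manifold ContDiff

namespace HyperbolicRoots

/-- The space of frequencies `ξ ∈ ℝⁿ` with its Euclidean norm. -/
abbrev Freq (n : ℕ) : Type := EuclideanSpace ℝ (Fin n)

/-- The unit sphere `𝕊ⁿ⁻¹` of `ℝⁿ`. -/
abbrev USphere (n : ℕ) : Type := Metric.sphere (0 : EuclideanSpace ℝ (Fin n)) 1

/-- For a polynomial `L(τ, ξ)` in `1 + n` variables (the variable of index `0` is `τ`, those of index
`1, …, n` are `ξ₁, …, ξₙ`), the polynomial `L(·, ξ)` in `τ` with `ξ ∈ ℝⁿ` as a parameter. -/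
noncomputable def polyAt {n : ℕ} (L : MvPolynomial (Fin (n + 1)) ℂ) (ξ : Freq n) : Polynomial ℂ :=
  (MvPolynomial.finSuccEquiv ℂ n L).map (MvPolynomial.eval fun i => ((ξ i : ℝ) : ℂ))

theorem eval_polyAt {n : ℕ} (L : MvPolynomial (Fin (n + 1)) ℂ) (ξ : Freq n) (z : ℂ) :
    (polyAt L ξ).eval z = MvPolynomial.eval (Fin.cons z fun i => ((ξ i : ℝ) : ℂ)) L := by
  rw [polyAt, MvPolynomial.eval_eq_eval_mv_eval']

/-- The total degree, with the convention that the zero polynomial has degree `-∞` (that is, `⊥`). -/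
noncomputable def totalDeg {n : ℕ} (p : MvPolynomial (Fin (n + 1)) ℂ) : WithBot ℕ :=
  p.support.sup fun s => (s.degree : WithBot ℕ)

theorem totalDeg_zero {n : ℕ} : totalDeg (0 : MvPolynomial (Fin (n + 1)) ℂ) = ⊥ := by
  simp [totalDeg]

theorem totalDeg_of_ne_zero {n : ℕ} {p : MvPolynomial (Fin (n + 1)) ℂ} (hp : p ≠ 0) :
    totalDeg p = (p.totalDegree : WithBot ℕ) := by
  have hs : p.support.Nonempty := MvPolynomial.support_nonempty.mpr hp
  apply le_antisymm
  · refine Finset.sup_le fun s hs => ?_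
    exact_mod_cast MvPolynomial.le_totalDegree hs
  · obtain ⟨s, hs, h⟩ := Finset.exists_mem_eq_sup p.support hs (fun s => s.sum fun _ e => e)
    have h1 : p.totalDegree = s.degree := h
    rw [h1]
    exact Finset.le_sup (f := fun s : Fin (n + 1) →₀ ℕ => (s.degree : WithBot ℕ)) hs

/-- `L` has degree `m`, and for every `ξ ≠ 0` its `m`-homogeneous part `L_m(·, ξ)` is a polynomial in
`τ` with exactly `m` roots, all real and pairwise distinct. (`Polynomial.roots` is the multiset of
roots with multiplicity, and is empty for the zero polynomial.) -/
def IsStrictlyHyperbolic {n : ℕ} (m : ℕ) (L : MvPolynomial (Fin (n + 1)) ℂ) : Prop :=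
  L.totalDegree = m ∧
    ∀ ξ : Freq n, ξ ≠ 0 → ∃ φ : Fin m → ℝ, Function.Injective φ ∧
      (polyAt (MvPolynomial.homogeneousComponent m L) ξ).roots =
        Finset.univ.val.map fun j => ((φ j : ℝ) : ℂ)

/-- A full asymptotic expansion of the characteristic roots of `L`:
`τ_j(ξ) ∼ |ξ| φ_j(η) + c_j⁽⁰⁾(η) + |ξ|⁻¹ c_j⁽¹⁾(η) + ⋯` as `|ξ| → ∞`, uniformly in `η = ξ / |ξ|`.
Here `ξ` is written as `r • η` with `r = |ξ| > 0`. -/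
structure IsRootExpansion {n : ℕ} (m : ℕ) (L : MvPolynomial (Fin (n + 1)) ℂ)
    (φ : Fin m → USphere n → ℝ) (τ : Fin m → Freq n → ℂ) (c : Fin m → ℕ → USphere n → ℂ) :
    Prop where
  /-- `φ_1(η), …, φ_m(η)` are the roots of the principal part `L_m(·, η)`. -/
  principal_roots : ∀ η : USphere n,
    (polyAt (MvPolynomial.homogeneousComponent m L) (η : Freq n)).roots =
      Finset.univ.val.map fun j => ((φ j η : ℝ) : ℂ)
  /-- `τ_1(ξ), …, τ_m(ξ)` are the roots of `L(·, ξ)`, listed with multiplicity. -/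
  char_roots : ∀ ξ : Freq n, (polyAt L ξ).roots = Finset.univ.val.map fun j => τ j ξ
  /-- Truncation before the term of order `|ξ|⁻ᴷ` leaves an error `O(|ξ|⁻ᴷ)`, uniformly in `η`. -/
  expansion : ∀ (j : Fin m) (K : ℕ), ∃ C R : ℝ, 0 < R ∧ ∀ r : ℝ, R ≤ r → ∀ η : USphere n,
    ‖τ j (r • (η : Freq n)) -
        ((r : ℂ) * (φ j η : ℂ) + ∑ k ∈ Finset.range K, ((r : ℂ) ^ k)⁻¹ * c j k η)‖ ≤ C * (r ^ K)⁻¹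

/-- `f` is an algebraic function on the sphere: for some polynomial `Q(η, z)`, every value `f(η)` is a
root of the one-variable polynomial `Q(η, ·)`, which is not the zero polynomial. -/
def IsAlgebraicFun {n : ℕ} (f : USphere n → ℂ) : Prop :=
  ∃ Q : MvPolynomial (Fin (n + 1)) ℂ, ∀ η : USphere n,
    polyAt Q (η : Freq n) ≠ 0 ∧ (polyAt Q (η : Freq n)).IsRoot (f η)

end HyperbolicRoots

/-!
Write `H = L_m` for the principal part, `a` for the coefficient of `τ ^ m` in `L` (nonzero if
`m > 0`, and free of `ξ`), and `τ = r z`, `ξ = r η` with `|η| = 1`.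

Both halves rest on one observation. Since `L(r z, r η) = a ∏ᵢ (r z - τᵢ(r η))`, a bound for `L` at a
point bounds the product of the distances from that point to the roots; if all roots but one stay
at a distance of order `r`, this is a bound for the distance to the remaining root
(`norm_sub_le_of_prod_le`). The same applies to `H` and its roots `r φᵢ`.

*Vanishing coefficients.* At `τ_j` the polynomial `L` vanishes, so `H = -(L - H)` is `O(r ^ d)` there.
Hence `τ_j - r φ_j = O(r ^ (d - m + 1))`, and the coefficients of larger order vanish one after
another (`IsRootExpansion.coeff_eq_zero`).

*Existence.* Let `φ_1 < ⋯ < φ_m` be the roots of `H(·, ξ)` in increasing order. They are smooth for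
`ξ ≠ 0` by the implicit function theorem (`contDiffAt_of_strictMono_roots`). With `ρ = 1 / r`, the
equation for `z` is `∑ₖ ρ ^ (m - k) L_k(z, η) = 0`, and `z = φ_j` is a simple root at `ρ = 0`.
Newton's method over the ring of functions `N(φ_j(η), η) / D(φ_j(η), η) ^ e` with `D = ∂H/∂τ`
(`fractionSubalgebra`) extends it to a formal power series in `ρ` (`exists_formal_root`), whose
coefficients are those of the expansion. Elements of this ring are visibly smooth, and they are
algebraic because a resultant eliminates `φ_j` (`isAlgebraicFun_of_mem_fractionSubalgebra`). At the
partial sums of the series `L` is small, uniformly in `η` by compactness of the sphere. The zeroth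
partial sum yields the labelling of the roots (`exists_labelling`), and the others yield the
remainder estimates (`norm_root_sub_le`).
-/

namespace HyperbolicRoots

variable {n : ℕ}

/-! ### The polynomials `L(·, ξ)` and their scaling -/

theorem eval_smul_of_isHomogeneous {σ R : Type*} [CommSemiring R] {p : MvPolynomial σ R} {k : ℕ}
    (hp : p.IsHomogeneous k) (r : R) (x : σ → R) :
    MvPolynomial.eval (fun i => r * x i) p = r ^ k * MvPolynomial.eval x p := by
  rw [MvPolynomial.eval_eq, MvPolynomial.eval_eq, Finset.mul_sum]
  refine Finset.sum_congr rfl fun s hs => ?_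
  have h : ∑ i ∈ s.support, s i = k := by
    have := hp (MvPolynomial.mem_support_iff.mp hs)
    simpa [Finsupp.weight_apply, Finsupp.sum] using this
  simp_rw [mul_pow, Finset.prod_mul_distrib, Finset.prod_pow_eq_pow_sum, h]
  ring


theorem polyAt_add (p q : MvPolynomial (Fin (n + 1)) ℂ) (ξ : Freq n) :
    polyAt (p + q) ξ = polyAt p ξ + polyAt q ξ := by
  simp [polyAt]

theorem eval_polyAt_smul {p : MvPolynomial (Fin (n + 1)) ℂ} {k : ℕ} (hp : p.IsHomogeneous k)
    (r : ℝ) (η : Freq n) (z : ℂ) :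
    (polyAt p (r • η)).eval (r * z) = (r : ℂ) ^ k * (polyAt p η).eval z := by
  rw [eval_polyAt, eval_polyAt, ← eval_smul_of_isHomogeneous hp]
  congr 2
  funext i
  refine Fin.cases ?_ (fun i => ?_) i <;> simp

theorem eval_polyAt_smul_eq_sum {p : MvPolynomial (Fin (n + 1)) ℂ} {d : ℕ}
    (hp : p.totalDegree ≤ d) (r : ℝ) (η : Freq n) (z : ℂ) :
    (polyAt p (r • η)).eval (r * z) = ∑ k ∈ Finset.range (d + 1), (r : ℂ) ^ k *
      (polyAt (MvPolynomial.homogeneousComponent k p) η).eval z := by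
  have hsum : ∑ k ∈ Finset.range (d + 1), MvPolynomial.homogeneousComponent k p = p := by
    conv_rhs => rw [← MvPolynomial.sum_homogeneousComponent p]
    refine (Finset.sum_subset (Finset.range_mono (by lia)) fun k _ hk => ?_).symm
    exact MvPolynomial.homogeneousComponent_eq_zero _ _ (by simpa using hk)
  conv_lhs => rw [← hsum]
  rw [eval_polyAt, map_sum]
  refine Finset.sum_congr rfl fun k _ => ?_
  rw [← eval_polyAt, eval_polyAt_smul (MvPolynomial.homogeneousComponent_isHomogeneous k p)]

/-- The coefficient of `τ ^ m`, for a polynomial of total degree at most `m`, is free of `ξ`. -/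
theorem coeff_polyAt {p : MvPolynomial (Fin (n + 1)) ℂ} {m : ℕ} (hp : p.totalDegree ≤ m)
    (ξ : Freq n) : (polyAt p ξ).coeff m = p.coeff (Finsupp.single 0 m) := by
  have h0 : ((MvPolynomial.finSuccEquiv ℂ n p).coeff m).totalDegree = 0 := by
    by_cases h : (MvPolynomial.finSuccEquiv ℂ n p).coeff m = 0
    · simp [h]
    · have := MvPolynomial.totalDegree_coeff_finSuccEquiv_add_le p m h
      lia
  rw [MvPolynomial.totalDegree_eq_zero_iff_eq_C] at h0
  rw [polyAt, Polynomial.coeff_map, h0, MvPolynomial.eval_C, MvPolynomial.finSuccEquiv_coeff_coeff]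
  congr 1
  ext i
  refine Fin.cases ?_ (fun i => ?_) i <;> simp [Fin.succ_ne_zero]

theorem natDegree_polyAt_le {p : MvPolynomial (Fin (n + 1)) ℂ} {m : ℕ} (hp : p.totalDegree ≤ m)
    (ξ : Freq n) : (polyAt p ξ).natDegree ≤ m := by
  refine Polynomial.natDegree_le_iff_coeff_eq_zero.mpr fun k hk => ?_
  rw [coeff_polyAt (hp.trans hk.le), ← MvPolynomial.notMem_support_iff]
  intro h
  have := MvPolynomial.le_totalDegree h
  simp at this
  lia

theorem natDegree_polyAt {p : MvPolynomial (Fin (n + 1)) ℂ} {m : ℕ} (hp : p.totalDegree ≤ m)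
    (ha : p.coeff (Finsupp.single 0 m) ≠ 0) (ξ : Freq n) : (polyAt p ξ).natDegree = m :=
  Polynomial.natDegree_eq_of_le_of_coeff_ne_zero (natDegree_polyAt_le hp ξ)
    (by rwa [coeff_polyAt hp])

theorem leadingCoeff_polyAt {p : MvPolynomial (Fin (n + 1)) ℂ} {m : ℕ} (hp : p.totalDegree ≤ m)
    (ha : p.coeff (Finsupp.single 0 m) ≠ 0) (ξ : Freq n) :
    (polyAt p ξ).leadingCoeff = p.coeff (Finsupp.single 0 m) := by
  rw [Polynomial.leadingCoeff, natDegree_polyAt hp ha, coeff_polyAt hp]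

theorem eval_polyAt_eq_prod {p : MvPolynomial (Fin (n + 1)) ℂ} {m : ℕ} (hp : p.totalDegree ≤ m)
    (ha : p.coeff (Finsupp.single 0 m) ≠ 0) {ξ : Freq n} {t : Fin m → ℂ}
    (ht : (polyAt p ξ).roots = Finset.univ.val.map t) (z : ℂ) :
    (polyAt p ξ).eval z = p.coeff (Finsupp.single 0 m) * ∏ j, (z - t j) := by
  rw [(IsAlgClosed.splits (polyAt p ξ)).eval_eq_prod_roots, leadingCoeff_polyAt hp ha, ht,
    Multiset.map_map]
  rfl

theorem totalDegree_homogeneousComponent_le (m : ℕ) (p : MvPolynomial (Fin (n + 1)) ℂ) :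
    (MvPolynomial.homogeneousComponent m p).totalDegree ≤ m :=
  (MvPolynomial.homogeneousComponent_isHomogeneous m p).totalDegree_le

theorem coeff_single_homogeneousComponent (m : ℕ) (p : MvPolynomial (Fin (n + 1)) ℂ) :
    (MvPolynomial.homogeneousComponent m p).coeff (Finsupp.single 0 m) =
      p.coeff (Finsupp.single 0 m) := by
  simp [MvPolynomial.coeff_homogeneousComponent]

/-- Strict hyperbolicity makes `τ ^ m` occur in `L`: otherwise `L_m(·, ξ)` has fewer than `m`
roots. -/
theorem IsStrictlyHyperbolic.coeff_ne_zero {m : ℕ} {L : MvPolynomial (Fin (n + 1 + 1)) ℂ}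
    (hL : IsStrictlyHyperbolic m L) (hm : m ≠ 0) : L.coeff (Finsupp.single 0 m) ≠ 0 := by
  obtain ⟨ξ, hξ⟩ := exists_ne (0 : Freq (n + 1))
  obtain ⟨φ, -, h⟩ := hL.2 ξ hξ
  have hdeg := totalDegree_homogeneousComponent_le m L
  have hcard : m ≤ (polyAt (MvPolynomial.homogeneousComponent m L) ξ).natDegree := by
    simpa [h] using Polynomial.card_roots' (polyAt (MvPolynomial.homogeneousComponent m L) ξ)
  have heq := hcard.antisymm' (natDegree_polyAt_le hdeg ξ)
  have h0 : polyAt (MvPolynomial.homogeneousComponent m L) ξ ≠ 0 := by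
    intro h0
    rw [h0, Polynomial.natDegree_zero] at heq
    exact hm heq.symm
  have := Polynomial.leadingCoeff_ne_zero.mpr h0
  rwa [Polynomial.leadingCoeff, heq, coeff_polyAt hdeg, coeff_single_homogeneousComponent] at this

theorem card_roots_polyAt {p : MvPolynomial (Fin (n + 1)) ℂ} {m : ℕ} (hp : p.totalDegree ≤ m)
    (ha : m ≠ 0 → p.coeff (Finsupp.single 0 m) ≠ 0) (ξ : Freq n) :
    (polyAt p ξ).roots.card = m := by
  by_cases hm : m = 0
  · have h1 := Polynomial.card_roots' (polyAt p ξ)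
    have h2 := natDegree_polyAt_le hp ξ
    lia
  · rw [← (IsAlgClosed.splits (polyAt p ξ)).natDegree_eq_card_roots, natDegree_polyAt hp (ha hm)]

/-- On bounded sets of `z`, a polynomial of total degree at most `d` is `O(rᵈ)` along `r (z, η)`. -/
theorem norm_eval_polyAt_smul_le {p : MvPolynomial (Fin (n + 1)) ℂ} {d : ℕ}
    (hp : p.totalDegree ≤ d) (η : Freq n) (B : ℝ) :
    ∃ C : ℝ, ∀ r : ℝ, 1 ≤ r → ∀ z : ℂ, ‖z‖ ≤ B →
      ‖(polyAt p (r • η)).eval (r * z)‖ ≤ C * r ^ d := by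
  have hb : ∀ k : ℕ, ∃ C : ℝ, ∀ z : ℂ, ‖z‖ ≤ B →
      ‖(polyAt (MvPolynomial.homogeneousComponent k p) η).eval z‖ ≤ C := fun k => by
    obtain ⟨C, hC⟩ := (isCompact_closedBall (0 : ℂ) B).exists_bound_of_continuousOn
      (polyAt (MvPolynomial.homogeneousComponent k p) η).continuous.continuousOn
    exact ⟨C, fun z hz => hC z (by simpa using hz)⟩
  choose C hC using hb
  refine ⟨∑ k ∈ Finset.range (d + 1), C k, fun r hr z hz => ?_⟩
  rw [eval_polyAt_smul_eq_sum hp, Finset.sum_mul]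
  refine norm_sum_le_of_le _ fun k hk => ?_
  rw [norm_mul, norm_pow, Complex.norm_real, Real.norm_of_nonneg (by linarith), mul_comm]
  have hC0 := (norm_nonneg _).trans (hC k z hz)
  gcongr
  · exact hC k z hz
  · simpa [Nat.lt_succ_iff] using hk

/-- Of `m` separated points, all but the nearest one stay away from `z`. So a bound for the product
of the distances from `z` to these points bounds the distance to the nearest one. -/
theorem norm_sub_le_of_prod_le {m : ℕ} {t : Fin m → ℂ} {z : ℂ} {δ M : ℝ} (hδ : 0 < δ) (j : Fin m)
    (hsep : ∀ i, i ≠ j → δ ≤ ‖z - t i‖) (hprod : ∏ i, ‖z - t i‖ ≤ M) :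
    ‖z - t j‖ ≤ M / δ ^ (m - 1) := by
  rw [le_div_iff₀ (by positivity)]
  refine le_trans ?_ hprod
  rw [← Finset.mul_prod_erase _ _ (Finset.mem_univ j)]
  gcongr
  calc δ ^ (m - 1) = ∏ i ∈ Finset.univ.erase j, δ := by
        simp
    _ ≤ _ := Finset.prod_le_prod (fun _ _ => hδ.le) fun i hi => hsep i (Finset.ne_of_mem_erase hi)

/-! ### Vanishing of the leading coefficients -/

theorem injective_of_roots_eq {m : ℕ} {L : MvPolynomial (Fin (n + 1)) ℂ}
    (hL : IsStrictlyHyperbolic m L) {ξ : Freq n} (hξ : ξ ≠ 0) {φ : Fin m → ℝ}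
    (h : (polyAt (MvPolynomial.homogeneousComponent m L) ξ).roots =
      Finset.univ.val.map fun j => ((φ j : ℝ) : ℂ)) : Function.Injective φ := by
  obtain ⟨ψ, hψ, h'⟩ := hL.2 ξ hξ
  have hnd : (Finset.univ.val.map fun j => ((φ j : ℝ) : ℂ)).Nodup := by
    rw [← h, h']
    exact Finset.univ.nodup.map (Complex.ofReal_injective.comp hψ)
  intro i j hij
  exact Multiset.inj_on_of_nodup_map hnd i (Finset.mem_univ i) j (Finset.mem_univ j)
    (by simp [hij])

theorem USphere.ne_zero (η : USphere n) : (η : Freq n) ≠ 0 :=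
  ne_zero_of_mem_unit_sphere η

theorem exists_pos_le_of_injective {m : ℕ} {φ : Fin m → ℝ} (hφ : Function.Injective φ)
    (j : Fin m) : ∃ δ > 0, ∀ i, i ≠ j → δ ≤ |φ j - φ i| := by
  have h : ∀ i, ∃ δ > 0, i ≠ j → δ ≤ |φ j - φ i| := fun i => by
    by_cases hij : i = j
    · exact ⟨1, one_pos, fun h => absurd hij h⟩
    · exact ⟨_, abs_pos.mpr (sub_ne_zero.mpr fun h => hij (hφ h).symm), fun _ => le_rfl⟩
  choose δ hpos hle using h
  have hne : (Finset.univ : Finset (Fin m)).Nonempty := ⟨j, Finset.mem_univ j⟩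
  refine ⟨Finset.univ.inf' hne δ, (Finset.lt_inf'_iff _).mpr fun i _ => hpos i, fun i hi => ?_⟩
  exact (Finset.inf'_le _ (Finset.mem_univ i)).trans (hle i hi)

/-- The growth bound for `p` of degree at most `m - k - 2`. The power of `r` stands on the left, so
that the zero polynomial, of degree `-∞`, is covered for every `k`. -/
theorem norm_eval_polyAt_smul_mul_le {p : MvPolynomial (Fin (n + 1)) ℂ} {m k : ℕ}
    (hk : totalDeg p + ((k + 2 : ℕ) : WithBot ℕ) ≤ (m : WithBot ℕ)) (η : Freq n) (B : ℝ) :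
    ∃ C : ℝ, ∀ r : ℝ, 1 ≤ r → ∀ z : ℂ, ‖z‖ ≤ B →
      ‖(polyAt p (r • η)).eval (r * z)‖ * r ^ (k + 2) ≤ C * r ^ m := by
  by_cases hp : p = 0
  · exact ⟨0, fun r hr z hz => by simp [hp, polyAt]⟩
  rw [totalDeg_of_ne_zero hp] at hk
  norm_cast at hk
  obtain ⟨C, hC⟩ := norm_eval_polyAt_smul_le (p := p) le_rfl η B
  refine ⟨C, fun r hr z hz => ?_⟩
  have h := hC r hr z hz
  have hr0 : 0 < r := by linarith
  have hC0 : 0 ≤ C := by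
    have := (norm_nonneg _).trans h
    exact nonneg_of_mul_nonneg_left this (by positivity)
  calc _ ≤ C * r ^ p.totalDegree * r ^ (k + 2) := by gcongr
    _ = C * r ^ (p.totalDegree + (k + 2)) := by ring
    _ ≤ C * r ^ m := by gcongr

/-- If `L - L_m` has degree at most `m - k - 2`, then `a ∏ᵢ (τ_j / r - φ_i) = O(r ^ (-(k + 2)))`,
because `L` vanishes at `τ_j`; the factors with `i ≠ j` are bounded below. -/
theorem IsRootExpansion.norm_sub_principal_le {m : ℕ} {L : MvPolynomial (Fin (n + 1 + 1)) ℂ}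
    (hL : IsStrictlyHyperbolic m L) {φ : Fin m → USphere (n + 1) → ℝ}
    {τ : Fin m → Freq (n + 1) → ℂ} {c : Fin m → ℕ → USphere (n + 1) → ℂ}
    (h : IsRootExpansion m L φ τ c) {k : ℕ}
    (hk : totalDeg (L - MvPolynomial.homogeneousComponent m L) + ((k + 2 : ℕ) : WithBot ℕ) ≤
      (m : WithBot ℕ)) (j : Fin m) (η : USphere (n + 1)) :
    ∃ C R : ℝ, 0 < R ∧ ∀ r : ℝ, R ≤ r →
      ‖τ j (r • (η : Freq (n + 1))) - (r : ℂ) * (φ j η : ℂ)‖ ≤ C * (r ^ (k + 1))⁻¹ := by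
  have hm : m ≠ 0 := by
    rintro rfl
    exact j.elim0
  have ha := hL.coeff_ne_zero hm
  set a := L.coeff (Finsupp.single 0 m)
  obtain ⟨δ, hδ, hsep⟩ := exists_pos_le_of_injective
    (injective_of_roots_eq hL (USphere.ne_zero η) (h.principal_roots η)) j
  obtain ⟨C₀, R₀, hR₀, h0⟩ := h.expansion j 0
  obtain ⟨C₁, h1⟩ := norm_eval_polyAt_smul_mul_le hk (η : Freq (n + 1)) (|φ j η| + δ / 2)
  -- For `r ≥ 2 C₀ / δ`, the order-zero estimate puts `z = τ_j / r` within `δ / 2` of `φ_j`.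
  refine ⟨C₁ / ‖a‖ / (δ / 2) ^ (m - 1), max R₀ (max 1 (2 * C₀ / δ)), by positivity,
    fun r hr => ?_⟩
  simp only [max_le_iff] at hr
  obtain ⟨hrR, hr1, hrC⟩ := hr
  have hr0 : 0 < r := by linarith
  have hrc : (r : ℂ) ≠ 0 := by exact_mod_cast hr0.ne'
  have h0 := h0 r hrR η
  simp only [Finset.range_zero, Finset.sum_empty, add_zero, pow_zero, inv_one, mul_one] at h0
  set t := τ j (r • (η : Freq (n + 1))) with ht
  obtain ⟨z, hz⟩ : ∃ z : ℂ, t = r * z := ⟨t / r, by field_simp⟩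
  have hzt : t - r * φ j η = r * (z - φ j η) := by rw [hz]; ring
  have hnorm : ‖t - r * φ j η‖ = r * ‖z - φ j η‖ := by
    rw [hzt, norm_mul, Complex.norm_real, Real.norm_of_nonneg hr0.le]
  have hclose : ‖z - φ j η‖ ≤ δ / 2 := by
    rw [div_le_iff₀ hδ] at hrC
    rw [hnorm] at h0
    by_contra! hlt
    nlinarith
  have hzB : ‖z‖ ≤ |φ j η| + δ / 2 := by
    calc ‖z‖ = ‖(φ j η : ℂ) + (z - φ j η)‖ := by congr 1; ring
      _ ≤ ‖(φ j η : ℂ)‖ + ‖z - φ j η‖ := norm_add_le _ _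
      _ ≤ _ := by
        rw [Complex.norm_real, Real.norm_eq_abs]
        gcongr
  have hfar : ∀ i, i ≠ j → δ / 2 ≤ ‖z - φ i η‖ := fun i hi => by
    have h2 : |φ j η - φ i η| ≤ ‖z - φ i η‖ + ‖z - φ j η‖ := by
      rw [← Real.norm_eq_abs, ← Complex.norm_real, Complex.ofReal_sub]
      calc _ = ‖(z - φ i η) - (z - φ j η)‖ := by congr 1; ring
        _ ≤ _ := norm_sub_le _ _
    linarith [hsep i hi]
  have hroot : (polyAt L (r • (η : Freq (n + 1)))).eval ((r : ℂ) * z) = 0 := by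
    have hmem : t ∈ (polyAt L (r • (η : Freq (n + 1)))).roots := by
      rw [h.char_roots]
      exact Multiset.mem_map_of_mem _ (Finset.mem_univ j)
    rw [← hz]
    exact (Polynomial.mem_roots'.mp hmem).2
  have hprin : (r : ℂ) ^ m * (a * ∏ i, (z - φ i η)) =
      -(polyAt (L - MvPolynomial.homogeneousComponent m L) (r • (η : Freq (n + 1)))).eval
        ((r : ℂ) * z) := by
    have hsplit := congrArg (Polynomial.eval ((r : ℂ) * z)) (polyAt_add
      (L - MvPolynomial.homogeneousComponent m L) (MvPolynomial.homogeneousComponent m L)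
      (r • (η : Freq (n + 1))))
    rw [sub_add_cancel, hroot, Polynomial.eval_add,
      eval_polyAt_smul (MvPolynomial.homogeneousComponent_isHomogeneous m L),
      eval_polyAt_eq_prod (totalDegree_homogeneousComponent_le m L)
        (by rwa [coeff_single_homogeneousComponent]) (h.principal_roots η),
      coeff_single_homogeneousComponent] at hsplit
    linear_combination -hsplit
  have hprod : ∏ i, ‖z - φ i η‖ ≤ C₁ / ‖a‖ / r ^ (k + 2) := by
    have h3 := h1 r hr1 z hzB
    rw [← norm_neg, ← hprin, norm_mul, norm_mul, norm_pow, Complex.norm_real,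
      Real.norm_of_nonneg hr0.le, norm_prod] at h3
    have ha' : 0 < ‖a‖ := norm_pos_iff.mpr ha
    rw [le_div_iff₀ (by positivity), le_div_iff₀ ha']
    have : 0 < r ^ m := by positivity
    refine le_of_mul_le_mul_right ?_ this
    linarith
  have hfinal := norm_sub_le_of_prod_le (half_pos hδ) j hfar hprod
  rw [hnorm]
  calc r * ‖z - φ j η‖ ≤ r * (C₁ / ‖a‖ / r ^ (k + 2) / (δ / 2) ^ (m - 1)) := by gcongr
    _ = _ := by
      field_simp
      ring

/-- The coefficients of the expansion vanish as long as their order exceeds that of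
`τ_j - r φ_j`. -/
theorem IsRootExpansion.coeff_eq_zero {m : ℕ} {L : MvPolynomial (Fin (n + 1 + 1)) ℂ}
    (hL : IsStrictlyHyperbolic m L) {φ : Fin m → USphere (n + 1) → ℝ}
    {τ : Fin m → Freq (n + 1) → ℂ} {c : Fin m → ℕ → USphere (n + 1) → ℂ}
    (h : IsRootExpansion m L φ τ c) (j : Fin m) (η : USphere (n + 1)) (k : ℕ)
    (hk : totalDeg (L - MvPolynomial.homogeneousComponent m L) + ((k + 2 : ℕ) : WithBot ℕ) ≤
      (m : WithBot ℕ)) : c j k η = 0 := by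
  induction k using Nat.strong_induction_on with
  | _ k ih =>
  obtain ⟨C₁, R₁, hR₁, h1⟩ := h.norm_sub_principal_le hL hk j η
  obtain ⟨C₂, R₂, hR₂, h2⟩ := h.expansion j (k + 1)
  have hbound : ∀ᶠ r : ℝ in Filter.atTop, ‖c j k η‖ ≤ (C₁ + C₂) * r⁻¹ := by
    filter_upwards [Filter.eventually_ge_atTop R₁, Filter.eventually_ge_atTop R₂] with r hr1 hr2
    have hr0 : 0 < r := by linarith
    have h1 := h1 r hr1
    have h2 := h2 r hr2 η
    have hsum : ∑ i ∈ Finset.range k, ((r : ℂ) ^ i)⁻¹ * c j i η = 0 := by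
      refine Finset.sum_eq_zero fun i hi => ?_
      rw [ih i (Finset.mem_range.mp hi), mul_zero]
      refine le_trans ?_ hk
      gcongr
      exact (Finset.mem_range.mp hi).le
    rw [Finset.sum_range_succ, hsum, zero_add] at h2
    set x := τ j (r • (η : Freq (n + 1)))
    have h3 : ‖((r : ℂ) ^ k)⁻¹ * c j k η‖ ≤ C₁ * (r ^ (k + 1))⁻¹ + C₂ * (r ^ (k + 1))⁻¹ := by
      calc _ = ‖(x - r * φ j η) - (x - (r * φ j η + ((r : ℂ) ^ k)⁻¹ * c j k η))‖ := by
            congr 1; ring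
        _ ≤ _ := (norm_sub_le _ _).trans (add_le_add h1 h2)
    rw [norm_mul, norm_inv, norm_pow, Complex.norm_real, Real.norm_of_nonneg hr0.le,
      inv_mul_le_iff₀ (by positivity)] at h3
    refine h3.trans (le_of_eq ?_)
    field_simp
    ring
  have hlim : Filter.Tendsto (fun r : ℝ => (C₁ + C₂) * r⁻¹) Filter.atTop (nhds 0) := by
    simpa using tendsto_inv_atTop_zero.const_mul (C₁ + C₂)
  exact norm_le_zero_iff.mp (ge_of_tendsto hlim hbound)

/-! ### Smoothness of the principal roots -/

theorem exists_strictMono_roots {m : ℕ} {L : MvPolynomial (Fin (n + 1)) ℂ}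
    (hL : IsStrictlyHyperbolic m L) : ∃ Φ : Fin m → Freq n → ℝ, ∀ ξ, ξ ≠ 0 →
      StrictMono (fun j => Φ j ξ) ∧ (polyAt (MvPolynomial.homogeneousComponent m L) ξ).roots =
        Finset.univ.val.map fun j => ((Φ j ξ : ℝ) : ℂ) := by
  have h : ∀ ξ : Freq n, ∃ φ : Fin m → ℝ, ξ ≠ 0 → StrictMono φ ∧
      (polyAt (MvPolynomial.homogeneousComponent m L) ξ).roots =
        Finset.univ.val.map fun j => ((φ j : ℝ) : ℂ) := fun ξ => by
    by_cases hξ : ξ = 0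
    · exact ⟨fun _ => 0, fun h => absurd hξ h⟩
    obtain ⟨φ, hφ, hr⟩ := hL.2 ξ hξ
    refine ⟨φ ∘ Tuple.sort φ, fun _ => ⟨(Tuple.monotone_sort φ).strictMono_of_injective
      (hφ.comp (Tuple.sort φ).injective), ?_⟩⟩
    have h2 := Multiset.map_univ_val_equiv (Tuple.sort φ)
    rw [hr]
    conv_lhs => rw [← h2, Multiset.map_map]
    rfl
  choose φ hφ using h
  exact ⟨fun j ξ => φ ξ j, hφ⟩

/-- Polynomial expressions in a function and the coordinates inherit its smoothness. -/
theorem contDiffAt_eval_polyAt {E : Type*} [NormedAddCommGroup E] [NormedSpace ℝ E]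
    (p : MvPolynomial (Fin (n + 1)) ℂ) {f : E → Freq n} {g : E → ℂ} {x : E}
    (hf : ContDiffAt ℝ ∞ f x) (hg : ContDiffAt ℝ ∞ g x) :
    ContDiffAt ℝ ∞ (fun y => (polyAt p (f y)).eval (g y)) x := by
  simp_rw [eval_polyAt]
  induction p using MvPolynomial.induction_on with
  | C a => simpa using contDiffAt_const
  | add p q hp hq => simpa using hp.add hq
  | mul_X p i hp =>
    simp only [map_mul, MvPolynomial.eval_X]
    refine hp.mul ?_
    refine Fin.cases ?_ (fun i => ?_) i
    · simpa using hg
    · simp only [Fin.cons_succ]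
      have h1 : ContDiffAt ℝ ∞ (fun y => f y i) x :=
        (EuclideanSpace.proj (𝕜 := ℝ) i).contDiff.contDiffAt.comp x hf
      exact Complex.ofRealCLM.contDiff.contDiffAt.comp x h1

/-- The principal part, divided by its leading coefficient, as a real function. -/
noncomputable def realPrincipal (m : ℕ) (L : MvPolynomial (Fin (n + 1)) ℂ) (x : Freq n × ℝ) : ℝ :=
  ((L.coeff (Finsupp.single 0 m))⁻¹ *
    (polyAt (MvPolynomial.homogeneousComponent m L) x.1).eval (x.2 : ℂ)).re

theorem contDiffAt_realPrincipal (m : ℕ) (L : MvPolynomial (Fin (n + 1)) ℂ) (x : Freq n × ℝ) :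
    ContDiffAt ℝ ∞ (realPrincipal m L) x := by
  refine Complex.reCLM.contDiff.contDiffAt.comp x (contDiffAt_const.mul ?_)
  exact contDiffAt_eval_polyAt _ contDiffAt_fst
    (Complex.ofRealCLM.contDiff.contDiffAt.comp x contDiffAt_snd)

theorem realPrincipal_eq_prod {m : ℕ} {L : MvPolynomial (Fin (n + 1)) ℂ}
    (ha : L.coeff (Finsupp.single 0 m) ≠ 0) {ξ : Freq n} {φ : Fin m → ℝ}
    (h : (polyAt (MvPolynomial.homogeneousComponent m L) ξ).roots =
      Finset.univ.val.map fun j => ((φ j : ℝ) : ℂ)) (t : ℝ) :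
    realPrincipal m L (ξ, t) = ∏ j, (t - φ j) := by
  rw [realPrincipal, eval_polyAt_eq_prod (totalDegree_homogeneousComponent_le m L)
    (by rwa [coeff_single_homogeneousComponent]) h, coeff_single_homogeneousComponent,
    inv_mul_cancel_left₀ ha]
  have : ∏ j, ((t : ℂ) - (φ j : ℂ)) = ((∏ j, (t - φ j) : ℝ) : ℂ) := by push_cast; rfl
  rw [this, Complex.ofReal_re]

/-- Near a simple root of the principal part, the implicit function theorem gives a smooth
branch of roots. -/
theorem exists_contDiffAt_branch {m : ℕ} {L : MvPolynomial (Fin (n + 1)) ℂ}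
    (ha : L.coeff (Finsupp.single 0 m) ≠ 0) {ξ : Freq n} {φ : Fin m → ℝ}
    (hφ : Function.Injective φ)
    (h : (polyAt (MvPolynomial.homogeneousComponent m L) ξ).roots =
      Finset.univ.val.map fun j => ((φ j : ℝ) : ℂ)) (j : Fin m) :
    ∃ ψ : Freq n → ℝ, ContDiffAt ℝ ∞ ψ ξ ∧ ψ ξ = φ j ∧
      ∀ᶠ x in nhds ξ, realPrincipal m L (x, ψ x) = 0 := by
  have hG := contDiffAt_realPrincipal m L (ξ, φ j)
  have hn : (∞ : WithTop ℕ∞) ≠ 0 := by simp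
  set A := fderiv ℝ (realPrincipal m L) (ξ, φ j) ∘L .inr ℝ (Freq n) ℝ with hA
  have h1 : HasDerivAt (fun t => realPrincipal m L (ξ, t)) (A 1) (φ j) := by
    have hd := (hG.differentiableAt hn).hasFDerivAt
    have hi : HasFDerivAt (fun t : ℝ => (ξ, t)) (.inr ℝ (Freq n) ℝ) (φ j) :=
      hasFDerivAt_prodMk_right ξ (φ j)
    exact (hd.comp (φ j) hi).hasDerivAt
  have h2 : HasDerivAt (fun t => realPrincipal m L (ξ, t))
      (∏ i ∈ Finset.univ.erase j, (φ j - φ i)) (φ j) := by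
    have heq : (fun t => realPrincipal m L (ξ, t)) =
        fun t => (t - φ j) * ∏ i ∈ Finset.univ.erase j, (t - φ i) := by
      funext t
      rw [realPrincipal_eq_prod ha h, Finset.mul_prod_erase _ (fun i => t - φ i)
        (Finset.mem_univ j)]
    have hdiff : DifferentiableAt ℝ (fun t => ∏ i ∈ Finset.univ.erase j, (t - φ i)) (φ j) := by
      fun_prop
    rw [heq]
    convert! ((hasDerivAt_id (φ j)).sub_const (φ j)).mul hdiff.hasDerivAt using 1
    simp
  -- The root `φ j` is simple, so the partial derivative `A` does not vanish.
  have hA1 : A 1 ≠ 0 := by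
    rw [h1.unique h2]
    refine Finset.prod_ne_zero_iff.mpr fun i hi => sub_ne_zero.mpr fun hij => ?_
    exact Finset.ne_of_mem_erase hi (hφ hij).symm
  have hinv : A.IsInvertible := by
    refine ⟨ContinuousLinearEquiv.unitsEquivAut ℝ (Units.mk0 _ hA1), ?_⟩
    ext
    simp
  refine ⟨hG.implicitFunction hn hinv, hG.contDiffAt_implicitFunction hn hinv,
    hG.implicitFunction_apply_self hn hinv, ?_⟩
  filter_upwards [hG.eventually_apply_implicitFunction hn hinv] with x hx
  rw [hx, realPrincipal_eq_prod ha h]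
  exact Finset.prod_eq_zero (Finset.mem_univ j) (sub_self _)

/-- The roots of the principal part in increasing order are smooth: near a given frequency the
smooth branches through the `m` roots stay in increasing order, so they are the ordered roots. -/
theorem contDiffAt_of_strictMono_roots {m : ℕ} {L : MvPolynomial (Fin (n + 1)) ℂ}
    (ha : L.coeff (Finsupp.single 0 m) ≠ 0) {Φ : Fin m → Freq n → ℝ}
    (hΦ : ∀ ξ, ξ ≠ 0 → StrictMono (fun j => Φ j ξ) ∧
      (polyAt (MvPolynomial.homogeneousComponent m L) ξ).roots =
        Finset.univ.val.map fun j => ((Φ j ξ : ℝ) : ℂ)) {ξ : Freq n} (hξ : ξ ≠ 0) (j : Fin m) :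
    ContDiffAt ℝ ∞ (Φ j) ξ := by
  choose ψ hψ hψ0 hψr using fun i => exists_contDiffAt_branch ha (hΦ ξ hξ).1.injective
    (hΦ ξ hξ).2 i
  refine (hψ j).congr_of_eventuallyEq ?_
  have hmono : ∀ᶠ x in nhds ξ, ∀ p : Fin m × Fin m, p.1 < p.2 → ψ p.1 x < ψ p.2 x := by
    refine Filter.eventually_all.mpr fun p => ?_
    by_cases hp : p.1 < p.2
    · have : ψ p.1 ξ < ψ p.2 ξ := by
        rw [hψ0, hψ0]
        exact (hΦ ξ hξ).1 hp
      filter_upwards [(hψ p.1).continuousAt.eventually_lt (hψ p.2).continuousAt this] with x hx _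
        using hx
    · exact Filter.Eventually.of_forall fun x h => absurd h hp
  filter_upwards [hmono, Filter.eventually_all.mpr hψr, isOpen_ne.mem_nhds hξ] with x hx hr hx0
  have hσ : ∀ i, ∃ k, ψ i x = Φ k x := fun i => by
    have := hr i
    rw [realPrincipal_eq_prod ha (hΦ x hx0).2, Finset.prod_eq_zero_iff] at this
    obtain ⟨k, -, hk⟩ := this
    exact ⟨k, sub_eq_zero.mp hk⟩
  choose σ hσ using hσ
  have hσm : StrictMono σ := fun i k hik => by
    rw [← (hΦ x hx0).1.lt_iff_lt]
    simpa only [← hσ] using hx (i, k) hik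
  have hid : σ j = j := le_antisymm hσm.apply_le hσm.le_apply
  rw [hσ, hid]

theorem contMDiff_comp_coe {F : Type*} [NormedAddCommGroup F] [NormedSpace ℝ F]
    {f : Freq (n + 1) → F} (hf : ∀ ξ, ξ ≠ 0 → ContDiffAt ℝ ∞ f ξ) :
    ContMDiff (𝓡 n) 𝓘(ℝ, F) ∞ fun η : USphere (n + 1) => f η := fun η =>
  haveI : Fact (Module.finrank ℝ (EuclideanSpace ℝ (Fin (n + 1))) = n + 1) :=
    ⟨finrank_euclideanSpace_fin⟩
  (hf _ (USphere.ne_zero η)).contMDiffAt.comp η (contMDiff_coe_sphere η)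

theorem exists_uniform_separation {m : ℕ} {φ : Fin m → USphere n → ℝ}
    (hc : ∀ j, Continuous (φ j)) (hφ : ∀ η, Function.Injective fun j => φ j η) :
    ∃ δ > 0, ∀ i j, i ≠ j → ∀ η, δ ≤ |φ j η - φ i η| := by
  have h : ∀ p : Fin m × Fin m, ∃ δ : ℝ, 0 < δ ∧ (p.1 ≠ p.2 → ∀ η, δ ≤ |φ p.2 η - φ p.1 η|) :=
    fun p => by
    by_cases hp : p.1 = p.2
    · exact ⟨1, one_pos, fun h => absurd hp h⟩
    obtain ⟨δ, hδ, hle⟩ := isCompact_univ.exists_forall_le' (f := fun η => |φ p.2 η - φ p.1 η|)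
      (a := 0) ((hc p.2).sub (hc p.1)).abs.continuousOn
      fun η _ => abs_pos.mpr (sub_ne_zero.mpr fun h => hp (hφ η h).symm)
    exact ⟨δ, hδ, fun _ η => hle η trivial⟩
  choose δ hpos hle using h
  by_cases hne : (Finset.univ : Finset (Fin m × Fin m)).Nonempty
  · refine ⟨Finset.univ.inf' hne δ, (Finset.lt_inf'_iff _).mpr fun i _ => hpos i,
      fun i j hij η => ?_⟩
    exact (Finset.inf'_le _ (Finset.mem_univ (i, j))).trans (hle (i, j) hij η)
  · exact ⟨1, one_pos, fun i j => absurd ⟨(i, j), Finset.mem_univ _⟩ hne⟩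

/-! ### The ring of coefficients and formal roots -/

section Formal

open Polynomial

variable {R : Type*} [CommRing R]

/-- One Newton step: a root modulo `X ^ (K + 1)`, simple at `X = 0`, is corrected to a root
modulo `X ^ (K + 2)`. -/
theorem exists_newton_step (p : R[X][X]) (S : R[X]) (K : ℕ)
    (hu : IsUnit ((p.derivative.eval S).coeff 0)) (hS : X ^ (K + 1) ∣ p.eval S) :
    ∃ c : R, X ^ (K + 2) ∣ p.eval (S + C c * X ^ (K + 1)) := by
  obtain ⟨g, hg⟩ := hS
  obtain ⟨v, hv⟩ := hu.exists_right_inv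
  refine ⟨-(v * g.coeff 0), ?_⟩
  obtain ⟨q, hq⟩ := p.binomExpansion S (C (-(v * g.coeff 0)) * X ^ (K + 1))
  have hX : X ∣ g + p.derivative.eval S * C (-(v * g.coeff 0)) := by
    rw [X_dvd_iff, coeff_add, coeff_mul_C]
    linear_combination -(g.coeff 0) * hv
  obtain ⟨w, hw⟩ := hX
  refine ⟨w + q * C (-(v * g.coeff 0)) ^ 2 * X ^ K, ?_⟩
  rw [hq, hg]
  linear_combination X ^ (K + 1) * hw

theorem coeff_zero_eval_eq {p : R[X][X]} {S T : R[X]} (h : X ∣ S - T) :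
    (p.eval S).coeff 0 = (p.eval T).coeff 0 := by
  have := X_dvd_iff.mp (h.trans (sub_dvd_eval_sub S T p))
  rwa [coeff_sub, sub_eq_zero] at this

/-- A simple root at `X = 0` extends to a formal power series root. -/
theorem exists_formal_root (p : R[X][X]) (f : R) (h0 : (p.eval (C f)).coeff 0 = 0)
    (hu : IsUnit ((p.derivative.eval (C f)).coeff 0)) :
    ∃ c : ℕ → R, ∀ K, X ^ (K + 1) ∣
      p.eval (C f + ∑ k ∈ Finset.range K, C (c k) * X ^ (k + 1)) := by
  have hstep : ∀ (K : ℕ) (S : R[X]), ∃ c : R, IsUnit ((p.derivative.eval S).coeff 0) →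
      X ^ (K + 1) ∣ p.eval S → X ^ (K + 2) ∣ p.eval (S + C c * X ^ (K + 1)) := fun K S => by
    by_cases h : IsUnit ((p.derivative.eval S).coeff 0) ∧ X ^ (K + 1) ∣ p.eval S
    · obtain ⟨c, hc⟩ := exists_newton_step p S K h.1 h.2
      exact ⟨c, fun _ _ => hc⟩
    · exact ⟨0, fun h1 h2 => absurd ⟨h1, h2⟩ h⟩
  choose c hc using hstep
  let S : ℕ → R[X] := fun K => Nat.rec (C f) (fun k T => T + C (c k T) * X ^ (k + 1)) K
  have hS : ∀ K, S K = C f + ∑ k ∈ Finset.range K, C (c k (S k)) * X ^ (k + 1) := fun K => by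
    induction K with
    | zero => simp [S]
    | succ K ih =>
      rw [Finset.sum_range_succ, ← add_assoc, ← ih]
  refine ⟨fun k => c k (S k), fun K => ?_⟩
  rw [← hS]
  induction K with
  | zero => simpa [S, X_dvd_iff] using h0
  | succ K ih =>
    refine hc K (S K) ?_ ih
    rw [coeff_zero_eval_eq (T := C f)]
    · exact hu
    · rw [hS, add_sub_cancel_left]
      exact Finset.dvd_sum fun k _ => ⟨C (c k (S k)) * X ^ k, by ring⟩

end Formal

/-- For a polynomial `D(z, η)` and a function `φ` on the sphere, the functions `f` of the form
`f(η) = N(φ(η), η) / D(φ(η), η)ᵉ` with `N` a polynomial. This is encoded without division, as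
`f(η) D(φ(η), η)ᵉ = N(φ(η), η)`; it is used where `D(φ(η), η)` has no zeros. -/
def fractionSubalgebra (D : MvPolynomial (Fin (n + 1)) ℂ) (φ : USphere n → ℂ) :
    Subalgebra ℂ (USphere n → ℂ) where
  carrier := {f | ∃ (N : MvPolynomial (Fin (n + 1)) ℂ) (e : ℕ), ∀ η : USphere n,
    f η * (polyAt D (η : Freq n)).eval (φ η) ^ e = (polyAt N (η : Freq n)).eval (φ η)}
  mul_mem' := by
    rintro f g ⟨N, e, hN⟩ ⟨M, k, hM⟩
    refine ⟨N * M, e + k, fun η => ?_⟩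
    have : (polyAt (N * M) (η : Freq n)).eval (φ η) =
        (polyAt N (η : Freq n)).eval (φ η) * (polyAt M (η : Freq n)).eval (φ η) := by
      simp [eval_polyAt]
    rw [this, ← hN, ← hM, Pi.mul_apply]
    ring
  add_mem' := by
    rintro f g ⟨N, e, hN⟩ ⟨M, k, hM⟩
    refine ⟨N * D ^ k + M * D ^ e, e + k, fun η => ?_⟩
    have : (polyAt (N * D ^ k + M * D ^ e) (η : Freq n)).eval (φ η) =
        (polyAt N (η : Freq n)).eval (φ η) * (polyAt D (η : Freq n)).eval (φ η) ^ k +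
        (polyAt M (η : Freq n)).eval (φ η) * (polyAt D (η : Freq n)).eval (φ η) ^ e := by
      simp [eval_polyAt]
    rw [this, ← hN, ← hM, Pi.add_apply]
    ring
  algebraMap_mem' := fun a => ⟨MvPolynomial.C a, 0, fun η => by simp [eval_polyAt]⟩

theorem mem_fractionSubalgebra {D : MvPolynomial (Fin (n + 1)) ℂ} {φ f : USphere n → ℂ} :
    f ∈ fractionSubalgebra D φ ↔ ∃ (N : MvPolynomial (Fin (n + 1)) ℂ) (e : ℕ), ∀ η : USphere n,
      f η * (polyAt D (η : Freq n)).eval (φ η) ^ e = (polyAt N (η : Freq n)).eval (φ η) :=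
  Iff.rfl

theorem polynomial_mem_fractionSubalgebra (D N : MvPolynomial (Fin (n + 1)) ℂ)
    (φ : USphere n → ℂ) :
    (fun η : USphere n => (polyAt N (η : Freq n)).eval (φ η)) ∈ fractionSubalgebra D φ :=
  ⟨N, 0, fun η => by simp⟩

/-- Such a function is a root of the resultant in `w` of `H(w, η)` and `z D(w, η)ᵉ - N(w, η)`, which
is not identically zero in `z` as `D` does not vanish at the roots of `H`. -/
theorem isAlgebraicFun_of_mem_fractionSubalgebra {m : ℕ} {H D : MvPolynomial (Fin (n + 1)) ℂ}
    (hH : H.totalDegree ≤ m) (ha : H.coeff (Finsupp.single 0 m) ≠ 0) {φ : USphere n → ℂ}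
    (hφ : ∀ η : USphere n, (polyAt H (η : Freq n)).eval (φ η) = 0)
    (hD : ∀ (η : USphere n) (w : ℂ), (polyAt H (η : Freq n)).eval w = 0 →
      (polyAt D (η : Freq n)).eval w ≠ 0) {f : USphere n → ℂ} (hf : f ∈ fractionSubalgebra D φ) :
    IsAlgebraicFun f := by
  obtain ⟨N, e, hN⟩ := hf
  -- The coefficients depend on `η` only; variable `0` is kept free for `z`.
  let ι : MvPolynomial (Fin n) ℂ →+* MvPolynomial (Fin (n + 1)) ℂ :=
    (MvPolynomial.rename Fin.succ : MvPolynomial (Fin n) ℂ →ₐ[ℂ] _).toRingHom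
  let F : MvPolynomial (Fin (n + 1)) ℂ → Polynomial (MvPolynomial (Fin (n + 1)) ℂ) :=
    fun p => (MvPolynomial.finSuccEquiv ℂ n p).map ι
  let G := Polynomial.C (MvPolynomial.X 0) * F D ^ e - F N
  let ev : ℂ → USphere n → MvPolynomial (Fin (n + 1)) ℂ →+* ℂ := fun z η =>
    MvPolynomial.eval (Fin.cons z fun i => (((η : Freq n) i : ℝ) : ℂ))
  have hFev : ∀ p z η, (F p).map (ev z η) = polyAt p (η : Freq n) := fun p z η => by
    rw [Polynomial.map_map, polyAt]
    congr 1
    ext i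
    · simp [ev, ι]
    · simp [ev, ι]
  have hGev : ∀ z η, G.map (ev z η) =
      Polynomial.C z * polyAt D (η : Freq n) ^ e - polyAt N (η : Freq n) := fun z η => by
    simp only [G, Polynomial.map_sub, Polynomial.map_mul, Polynomial.map_pow, hFev,
      Polynomial.map_C]
    simp [ev]
  let Q := Polynomial.resultant (F H) G m G.natDegree
  have hQ : ∀ (z : ℂ) (η : USphere n), (polyAt Q (η : Freq n)).eval z = 0 ↔ ∃ w,
      (polyAt H (η : Freq n)).eval w = 0 ∧
        z * (polyAt D (η : Freq n)).eval w ^ e = (polyAt N (η : Freq n)).eval w := fun z η => by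
    have hH0 : polyAt H (η : Freq n) ≠ 0 := by
      rw [← Polynomial.leadingCoeff_ne_zero, leadingCoeff_polyAt hH ha]
      exact ha
    have h1 : (polyAt Q (η : Freq n)).eval z = ev z η Q := eval_polyAt _ _ _
    rw [h1, ← Polynomial.resultant_map_map, hFev]
    obtain ⟨l, hl⟩ := Nat.exists_eq_add_of_le (Polynomial.natDegree_map_le (p := G) (f := ev z η))
    -- The degree of `G` may drop at `(z, η)`; this only multiplies the resultant by a power of `a`.
    rw [hl, Polynomial.resultant_add_right_deg _ _ _ _ _ le_rfl, coeff_polyAt hH,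
      mul_eq_zero_iff_left (pow_ne_zero _ ha), ← natDegree_polyAt hH ha (η : Freq n),
      Polynomial.resultant_eq_zero_iff, hGev,
      Polynomial.isCoprime_iff_aeval_ne_zero_of_isAlgClosed ℂ ℂ]
    simp [hH0, sub_eq_zero]
  refine ⟨Q, fun η => ⟨fun h0 => ?_, (hQ _ _).mpr ⟨φ η, hφ η, hN η⟩⟩⟩
  obtain ⟨z, hz⟩ := Infinite.exists_notMem_finset ((polyAt H (η : Freq n)).roots.toFinset.image
    fun w => (polyAt N (η : Freq n)).eval w / (polyAt D (η : Freq n)).eval w ^ e)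
  refine hz (Finset.mem_image.mpr ?_)
  obtain ⟨w, hw, hzw⟩ := (hQ z η).mp (by rw [h0, Polynomial.eval_zero])
  refine ⟨w, ?_, ?_⟩
  · rw [Multiset.mem_toFinset, Polynomial.mem_roots']
    refine ⟨?_, hw⟩
    rw [← Polynomial.leadingCoeff_ne_zero, leadingCoeff_polyAt hH ha]
    exact ha
  · rw [← hzw, mul_div_cancel_right₀ _ (pow_ne_zero _ (hD η w hw))]

theorem contMDiff_of_mem_fractionSubalgebra {D : MvPolynomial (Fin (n + 1 + 1)) ℂ}
    {Φ : Freq (n + 1) → ℝ} (hΦ : ∀ ξ, ξ ≠ 0 → ContDiffAt ℝ ∞ Φ ξ)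
    (hD : ∀ ξ, ξ ≠ 0 → (polyAt D ξ).eval (Φ ξ : ℂ) ≠ 0) {f : USphere (n + 1) → ℂ}
    (hf : f ∈ fractionSubalgebra D fun η => (Φ η : ℂ)) : ContMDiff (𝓡 n) 𝓘(ℝ, ℂ) ∞ f := by
  obtain ⟨N, e, hN⟩ := hf
  have heq : f = fun η : USphere (n + 1) => (fun ξ : Freq (n + 1) =>
      (polyAt N ξ).eval (Φ ξ : ℂ) / (polyAt D ξ).eval (Φ ξ : ℂ) ^ e) η := by
    funext η
    exact eq_div_of_mul_eq (pow_ne_zero _ (hD _ (USphere.ne_zero η))) (hN η)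
  rw [heq]
  refine contMDiff_comp_coe (f := fun ξ : Freq (n + 1) =>
      (polyAt N ξ).eval (Φ ξ : ℂ) / (polyAt D ξ).eval (Φ ξ : ℂ) ^ e) fun ξ hξ => ?_
  have h1 : ContDiffAt ℝ ∞ (fun ξ => (Φ ξ : ℂ)) ξ :=
    Complex.ofRealCLM.contDiff.contDiffAt.comp ξ (hΦ ξ hξ)
  have hDξ := ((contDiffAt_eval_polyAt D contDiffAt_id h1).pow e).inv (pow_ne_zero _ (hD ξ hξ))
  exact (contDiffAt_eval_polyAt N contDiffAt_id h1).mul hDξ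

/-- The derivative of a polynomial `p(τ, ξ)` with respect to `τ`. -/
noncomputable def tauDeriv (p : MvPolynomial (Fin (n + 1)) ℂ) : MvPolynomial (Fin (n + 1)) ℂ :=
  (MvPolynomial.finSuccEquiv ℂ n).symm (MvPolynomial.finSuccEquiv ℂ n p).derivative

theorem polyAt_tauDeriv (p : MvPolynomial (Fin (n + 1)) ℂ) (ξ : Freq n) :
    polyAt (tauDeriv p) ξ = (polyAt p ξ).derivative := by
  simp [polyAt, tauDeriv, Polynomial.derivative_map]

theorem eval_tauDeriv_ne_zero {m : ℕ} {p : MvPolynomial (Fin (n + 1)) ℂ} (hp : p.totalDegree ≤ m)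
    (ha : p.coeff (Finsupp.single 0 m) ≠ 0) {ξ : Freq n} {t : Fin m → ℂ}
    (hinj : Function.Injective t) (ht : (polyAt p ξ).roots = Finset.univ.val.map t) {w : ℂ}
    (hw : (polyAt p ξ).eval w = 0) : (polyAt (tauDeriv p) ξ).eval w ≠ 0 := by
  rw [polyAt_tauDeriv]
  intro h
  have h0 : polyAt p ξ ≠ 0 := by
    rw [← Polynomial.leadingCoeff_ne_zero, leadingCoeff_polyAt hp ha]
    exact ha
  have h1 := (Polynomial.one_lt_rootMultiplicity_iff_isRoot h0).mpr ⟨hw, h⟩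
  have h2 : (polyAt p ξ).roots.Nodup := ht ▸ Finset.univ.nodup.map hinj
  have h3 := Multiset.nodup_iff_count_le_one.mp h2 w
  rw [Polynomial.count_roots] at h3
  lia

/-- The coefficients of the expansion of `τ_j`, from the formal root of
`∑ₖ ρ ^ (m - k) L_k(z, η)` extending `φ_j` at `ρ = 0`. Each partial sum makes `L` small. -/
theorem exists_expansion_coeff {m : ℕ} {L : MvPolynomial (Fin (n + 1)) ℂ}
    (hdeg : L.totalDegree ≤ m) {φ : USphere n → ℂ}
    (hφ : ∀ η : USphere n,
      (polyAt (MvPolynomial.homogeneousComponent m L) (η : Freq n)).eval (φ η) = 0)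
    (hD : ∀ η : USphere n,
      (polyAt (tauDeriv (MvPolynomial.homogeneousComponent m L)) (η : Freq n)).eval (φ η) ≠ 0)
    (hb : ∀ f ∈ fractionSubalgebra (tauDeriv (MvPolynomial.homogeneousComponent m L)) φ,
      ∃ C : ℝ, ∀ η, ‖f η‖ ≤ C) :
    ∃ c : ℕ → USphere n → ℂ,
      (∀ k, c k ∈ fractionSubalgebra (tauDeriv (MvPolynomial.homogeneousComponent m L)) φ) ∧
      ∀ K, ∃ C : ℝ, ∀ r : ℝ, 1 ≤ r → ∀ η : USphere n,
        ‖(polyAt L (r • (η : Freq n))).eval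
          ((r : ℂ) * φ η + ∑ k ∈ Finset.range K, ((r : ℂ) ^ k)⁻¹ * c k η)‖ * r ^ (K + 1) ≤
            C * r ^ m := by
  set D := tauDeriv (MvPolynomial.homogeneousComponent m L) with hDdef
  set A := fractionSubalgebra D φ with hA
  -- The coordinates and `φ` as elements of the ring `A`, and the evaluation of `A[ρ]` at `(η, ρ)`.
  let x : Fin n → A := fun i => ⟨fun η => (((η : Freq n) i : ℝ) : ℂ),
    by simpa [eval_polyAt] using polynomial_mem_fractionSubalgebra D (MvPolynomial.X i.succ) φ⟩
  let φA : A := ⟨φ,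
    by simpa [eval_polyAt] using polynomial_mem_fractionSubalgebra D (MvPolynomial.X 0) φ⟩
  let ev : USphere n → A →+* ℂ := fun η =>
    (Pi.evalRingHom (fun _ : USphere n => ℂ) η).comp A.val.toRingHom
  let h : USphere n → ℂ → Polynomial A →+* ℂ := fun η ρ => Polynomial.eval₂RingHom (ev η) ρ
  -- The polynomial `∑ₖ ρ ^ (m - k) L_k(z, η)` in `z`, with coefficients in `A[ρ]`.
  let p : Polynomial (Polynomial A) := ∑ k ∈ Finset.range (m + 1),
    Polynomial.C (Polynomial.X ^ (m - k)) *
      (MvPolynomial.finSuccEquiv ℂ n (MvPolynomial.homogeneousComponent k L)).map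
        (Polynomial.C.comp (MvPolynomial.aeval x).toRingHom)
  have hp : ∀ η ρ, p.map (h η ρ) = ∑ k ∈ Finset.range (m + 1),
      Polynomial.C (ρ ^ (m - k)) *
        polyAt (MvPolynomial.homogeneousComponent k L) (η : Freq n) := fun η ρ => by
    rw [Polynomial.map_sum]
    refine Finset.sum_congr rfl fun k _ => ?_
    rw [Polynomial.map_mul, Polynomial.map_map, Polynomial.map_C, polyAt]
    congr 2
    · simp [h]
    · ext i
      · simp [h, ev]
      · simp [h, ev, x]
  have hp0 : ∀ η, p.map (h η 0) =
      polyAt (MvPolynomial.homogeneousComponent m L) (η : Freq n) := fun η => by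
    rw [hp, Finset.sum_range_succ, Finset.sum_eq_zero fun k hk => ?_]
    · simp
    · have : m - k ≠ 0 := by
        have := Finset.mem_range.mp hk
        lia
      simp [this]
  have hcoeff : ∀ (q : Polynomial A) (η : USphere n), (q.coeff 0 : USphere n → ℂ) η = h η 0 q :=
    fun q η => (Polynomial.eval₂_at_zero (ev η)).symm
  have hφev : ∀ η ρ, h η ρ (Polynomial.C φA) = φ η := fun η ρ => by simp [h, ev, φA]
  have hval : ∀ η ρ (q : Polynomial (Polynomial A)) S,
      h η ρ (q.eval S) = (q.map (h η ρ)).eval (h η ρ S) := fun η ρ q S => by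
    exact (Polynomial.eval_map_apply _ _).symm
  obtain ⟨c, hc⟩ := exists_formal_root p φA
    (by
      ext η
      rw [hcoeff, hval, hp0, hφev, hφ]
      rfl)
    (by
      have hmem : (fun η : USphere n => ((polyAt D (η : Freq n)).eval (φ η))⁻¹) ∈ A :=
        mem_fractionSubalgebra.mpr ⟨1, 1, fun η => by
          rw [pow_one, inv_mul_cancel₀ (hD η)]
          simp [eval_polyAt]⟩
      refine IsUnit.of_mul_eq_one ⟨_, hmem⟩ ?_
      ext η
      have : ((p.derivative.eval (Polynomial.C φA)).coeff 0 : USphere n → ℂ) η =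
          (polyAt D (η : Freq n)).eval (φ η) := by
        rw [hcoeff, hval, ← Polynomial.derivative_map, hp0, hφev, hDdef, polyAt_tauDeriv]
      change ((p.derivative.eval (Polynomial.C φA)).coeff 0 : USphere n → ℂ) η * _ = 1
      rw [this, mul_inv_cancel₀ (hD η)])
  refine ⟨fun k => c k, fun k => (c k).2, fun K => ?_⟩
  -- At the partial sum, `p` is `ρ ^ (K + 1) g`, and `g` is bounded for `ρ = 1 / r ≤ 1`.
  obtain ⟨g, hg⟩ := hc K
  choose C hC using fun i => hb _ (g.coeff i).2
  refine ⟨∑ i ∈ g.support, C i, fun r hr η => ?_⟩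
  have hr0 : 0 < r := by linarith
  have hrc : (r : ℂ) ≠ 0 := by exact_mod_cast hr0.ne'
  have hgb : ‖h η (r : ℂ)⁻¹ g‖ ≤ ∑ i ∈ g.support, C i := by
    change ‖Polynomial.eval₂ (ev η) (r : ℂ)⁻¹ g‖ ≤ _
    rw [Polynomial.eval₂_eq_sum, Polynomial.sum_def]
    refine norm_sum_le_of_le _ fun i _ => ?_
    have h1 : ‖((r : ℂ)⁻¹) ^ i‖ ≤ 1 := by
      rw [norm_pow, norm_inv, Complex.norm_real, Real.norm_of_nonneg hr0.le]
      exact pow_le_one₀ (by positivity) (inv_le_one_of_one_le₀ hr)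
    rw [norm_mul]
    exact (mul_le_of_le_one_right (norm_nonneg _) h1).trans (hC i η)
  have hS : (r : ℂ) * φ η + ∑ k ∈ Finset.range K, ((r : ℂ) ^ k)⁻¹ * (c k : USphere n → ℂ) η =
      r * h η (r : ℂ)⁻¹ (Polynomial.C φA +
        ∑ k ∈ Finset.range K, Polynomial.C (c k) * Polynomial.X ^ (k + 1)) := by
    rw [map_add, map_sum, hφev, mul_add, Finset.mul_sum]
    congr 1
    refine Finset.sum_congr rfl fun k _ => ?_
    have : h η (r : ℂ)⁻¹ (Polynomial.C (c k) * Polynomial.X ^ (k + 1)) =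
        (c k : USphere n → ℂ) η * ((r : ℂ)⁻¹) ^ (k + 1) := by simp [h, ev]
    rw [this, inv_pow]
    field_simp
    ring
  have hL : (polyAt L (r • (η : Freq n))).eval
      ((r : ℂ) * φ η + ∑ k ∈ Finset.range K, ((r : ℂ) ^ k)⁻¹ * (c k : USphere n → ℂ) η) *
        (r : ℂ) ^ (K + 1) = r ^ m * h η (r : ℂ)⁻¹ g := by
    have h1 := congrArg (h η (r : ℂ)⁻¹) hg
    rw [hval, hp] at h1
    rw [hS, eval_polyAt_smul_eq_sum hdeg]
    set s := h η (r : ℂ)⁻¹ (Polynomial.C φA +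
        ∑ k ∈ Finset.range K, Polynomial.C (c k) * Polynomial.X ^ (k + 1))
    have h2 : h η (r : ℂ)⁻¹ (Polynomial.X ^ (K + 1) * g) =
        ((r : ℂ)⁻¹) ^ (K + 1) * h η (r : ℂ)⁻¹ g := by
      rw [map_mul, map_pow]
      simp [h]
    have h3 : ∑ k ∈ Finset.range (m + 1), (r : ℂ) ^ k *
        (polyAt (MvPolynomial.homogeneousComponent k L) (η : Freq n)).eval s =
        r ^ m * (((r : ℂ)⁻¹) ^ (K + 1) * h η (r : ℂ)⁻¹ g) := by
      rw [← h2, ← h1, Polynomial.eval_finsetSum, Finset.mul_sum]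
      refine Finset.sum_congr rfl fun k hk => ?_
      have hkm : k ≤ m := by simpa [Nat.lt_succ_iff] using hk
      rw [Polynomial.eval_mul, Polynomial.eval_C, ← mul_assoc, inv_pow,
        ← pow_sub₀ _ hrc (Nat.sub_le m k), Nat.sub_sub_self hkm]
    rw [h3, inv_pow]
    generalize h η (r : ℂ)⁻¹ g = y
    field_simp
  have := congrArg norm hL
  rw [norm_mul, norm_mul, norm_pow, norm_pow, Complex.norm_real, Real.norm_of_nonneg hr0.le] at this
  rw [this, mul_comm]
  gcongr

/-! ### Labelling of the roots and remainder estimates -/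

theorem exists_roots_eq_map {m : ℕ} {p : MvPolynomial (Fin (n + 1)) ℂ} (hp : p.totalDegree ≤ m)
    (ha : m ≠ 0 → p.coeff (Finsupp.single 0 m) ≠ 0) (ξ : Freq n) :
    ∃ t : Fin m → ℂ, (polyAt p ξ).roots = Finset.univ.val.map t := by
  have hcard := card_roots_polyAt hp ha ξ
  revert hcard
  generalize (polyAt p ξ).roots = s
  induction s using Quot.inductionOn with
  | _ l =>
  intro hl
  have hl' : l.length = m := hl
  subst hl'
  refine ⟨l.get, ?_⟩
  rw [Fin.univ_val_map, List.ofFn_get]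
  rfl

/-- If `L` is small at the separated points `r φ_j`, then each of them has a root nearby, and
distinct points have distinct roots nearby. This labels the roots by the points. -/
theorem exists_labelling {m : ℕ} {L : MvPolynomial (Fin (n + 1)) ℂ} (hdeg : L.totalDegree ≤ m)
    (ha : L.coeff (Finsupp.single 0 m) ≠ 0) {ξ : Freq n} {φ : Fin m → ℝ} {δ r : ℝ} (hδ : 0 < δ)
    (hr : 0 < r) (hsep : ∀ i j, i ≠ j → δ ≤ |φ j - φ i|)
    (hsmall : ∀ j, ‖(polyAt L ξ).eval ((r : ℂ) * φ j)‖ <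
      ‖L.coeff (Finsupp.single 0 m)‖ * (δ / 4 * r) ^ m) :
    ∃ t : Fin m → ℂ, (polyAt L ξ).roots = Finset.univ.val.map t ∧
      ∀ j, ‖t j - (r : ℂ) * φ j‖ ≤ δ / 4 * r := by
  obtain ⟨t, ht⟩ := exists_roots_eq_map hdeg (fun _ => ha) ξ
  have hnear : ∀ j, ∃ i, ‖t i - (r : ℂ) * φ j‖ ≤ δ / 4 * r := fun j => by
    by_contra! hfar
    refine (hsmall j).not_ge ?_
    rw [eval_polyAt_eq_prod hdeg ha ht, norm_mul, norm_prod]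
    gcongr
    calc (δ / 4 * r) ^ m = ∏ _i : Fin m, (δ / 4 * r) := by simp
      _ ≤ _ := Finset.prod_le_prod (fun _ _ => by positivity) fun i _ => by
        rw [norm_sub_rev]
        exact (hfar i).le
  choose σ hσ using hnear
  have hinj : Function.Injective σ := fun i j hij => by
    by_contra hne
    have h1 : ‖(r : ℂ) * φ j - r * φ i‖ ≤ δ / 4 * r + δ / 4 * r := by
      calc _ = ‖(t (σ i) - (r : ℂ) * φ i) - (t (σ j) - (r : ℂ) * φ j)‖ := by
            rw [hij]; congr 1; ring
        _ ≤ _ := (norm_sub_le _ _).trans (add_le_add (hσ i) (hσ j))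
    rw [← mul_sub, norm_mul, ← Complex.ofReal_sub, Complex.norm_real, Complex.norm_real,
      Real.norm_of_nonneg hr.le, Real.norm_eq_abs] at h1
    nlinarith [hsep i j hne, mul_pos hδ hr]
  let e : Fin m ≃ Fin m := Equiv.ofBijective σ (Finite.injective_iff_bijective.mp hinj)
  refine ⟨fun j => t (σ j), ?_, hσ⟩
  rw [ht]
  conv_lhs => rw [← Multiset.map_univ_val_equiv e, Multiset.map_map]
  rfl

/-- Any labelling of the roots of `L` that follows `r φ_j(η)` has the expansion whose partial sums
make `L` small: at such a sum the product of the distances to all roots is small, and only the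
distance to `τ_j` can be. -/
theorem norm_root_sub_le {m : ℕ} {L : MvPolynomial (Fin (n + 1)) ℂ} (hdeg : L.totalDegree ≤ m)
    (ha : L.coeff (Finsupp.single 0 m) ≠ 0) {φ : Fin m → USphere n → ℝ}
    {τ : Fin m → Freq n → ℂ} {c : ℕ → USphere n → ℂ} {δ R : ℝ} (hδ : 0 < δ)
    (hsep : ∀ i j, i ≠ j → ∀ η, δ ≤ |φ j η - φ i η|)
    (hroots : ∀ ξ, (polyAt L ξ).roots = Finset.univ.val.map fun j => τ j ξ)
    (hclose : ∀ r : ℝ, R ≤ r → ∀ (η : USphere n) j,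
      ‖τ j (r • (η : Freq n)) - (r : ℂ) * φ j η‖ ≤ δ / 4 * r)
    (hb : ∀ k, ∃ B : ℝ, ∀ η, ‖c k η‖ ≤ B) (j : Fin m) (K : ℕ)
    (hc : ∃ C : ℝ, ∀ r : ℝ, 1 ≤ r → ∀ η : USphere n,
      ‖(polyAt L (r • (η : Freq n))).eval
        ((r : ℂ) * φ j η + ∑ k ∈ Finset.range K, ((r : ℂ) ^ k)⁻¹ * c k η)‖ * r ^ (K + 1) ≤
          C * r ^ m) :
    ∃ C R : ℝ, 0 < R ∧ ∀ r : ℝ, R ≤ r → ∀ η : USphere n,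
      ‖τ j (r • (η : Freq n)) -
        ((r : ℂ) * (φ j η : ℂ) + ∑ k ∈ Finset.range K, ((r : ℂ) ^ k)⁻¹ * c k η)‖ ≤
          C * (r ^ K)⁻¹ := by
  obtain ⟨C, hC⟩ := hc
  choose B hB using hb
  have ha' : 0 < ‖L.coeff (Finsupp.single 0 m)‖ := norm_pos_iff.mpr ha
  set a := L.coeff (Finsupp.single 0 m)
  obtain ⟨l, rfl⟩ : ∃ l, m = l + 1 := Nat.exists_eq_succ_of_ne_zero fun h => (h ▸ j).elim0
  refine ⟨C / ‖a‖ / (δ / 2) ^ l, max R (max 1 ((∑ k ∈ Finset.range K, B k) / (δ / 4))),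
    by positivity, fun r hr η => ?_⟩
  simp only [max_le_iff] at hr
  obtain ⟨hrR, hr1, hrB⟩ := hr
  have hr0 : 0 < r := by linarith
  have hsum : ‖∑ k ∈ Finset.range K, ((r : ℂ) ^ k)⁻¹ * c k η‖ ≤ δ / 4 * r := by
    rw [div_le_iff₀ (by positivity), mul_comm] at hrB
    refine le_trans (norm_sum_le_of_le _ fun k _ => ?_) hrB
    rw [norm_mul, norm_inv, norm_pow, Complex.norm_real, Real.norm_of_nonneg hr0.le]
    exact (mul_le_of_le_one_left (norm_nonneg _) (inv_le_one_of_one_le₀ (one_le_pow₀ hr1))).trans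
      (hB k η)
  have hC := hC r hr1 η
  rw [eval_polyAt_eq_prod hdeg ha (hroots _), norm_mul, norm_prod] at hC
  set y := ∑ k ∈ Finset.range K, ((r : ℂ) ^ k)⁻¹ * c k η
  have hfar : ∀ i, i ≠ j →
      δ / 2 * r ≤ ‖(r : ℂ) * φ j η + y - τ i (r • (η : Freq n))‖ := fun i hi => by
    have h1 : ‖(r : ℂ) * (φ j η - φ i η)‖ ≤
        ‖(r : ℂ) * φ j η + y - τ i (r • (η : Freq n))‖ + δ / 4 * r + δ / 4 * r := by
      calc _ = ‖((r : ℂ) * φ j η + y - τ i (r • (η : Freq n))) +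
            (τ i (r • (η : Freq n)) - r * φ i η) - y‖ := by congr 1; ring
        _ ≤ _ := (norm_sub_le _ _).trans
          (add_le_add ((norm_add_le _ _).trans (add_le_add le_rfl (hclose r hrR η i))) hsum)
    rw [norm_mul, ← Complex.ofReal_sub, Complex.norm_real, Complex.norm_real,
      Real.norm_of_nonneg hr0.le, Real.norm_eq_abs] at h1
    nlinarith [hsep i j hi η]
  have hprod : ∏ i, ‖(r : ℂ) * φ j η + y - τ i (r • (η : Freq n))‖ ≤
      C / ‖a‖ * r ^ (l + 1) / r ^ (K + 1) := by
    rw [le_div_iff₀ (by positivity), div_mul_eq_mul_div, le_div_iff₀ ha']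
    linarith
  have h2 := norm_sub_le_of_prod_le (by positivity) j hfar hprod
  rw [norm_sub_rev]
  refine h2.trans (le_of_eq ?_)
  rw [Nat.add_sub_cancel]
  field_simp
  ring

/-- The expansion exists, with `φ_j` the ordered principal roots and with coefficients that are
rational in `φ_j` and the coordinates. -/
theorem IsStrictlyHyperbolic.exists_isRootExpansion {m : ℕ}
    {L : MvPolynomial (Fin (n + 1 + 1)) ℂ} (hL : IsStrictlyHyperbolic m L) (hm : m ≠ 0) :
    ∃ (φ : Fin m → USphere (n + 1) → ℝ) (τ : Fin m → Freq (n + 1) → ℂ)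
      (c : Fin m → ℕ → USphere (n + 1) → ℂ),
      IsRootExpansion m L φ τ c ∧
      (∀ j, ContMDiff (𝓡 n) 𝓘(ℝ, ℝ) ∞ (φ j)) ∧
      (∀ j k, ContMDiff (𝓡 n) 𝓘(ℝ, ℂ) ∞ (c j k)) ∧
      (∀ j k, IsAlgebraicFun (c j k)) := by
  have hdeg : L.totalDegree ≤ m := hL.1.le
  have ha := hL.coeff_ne_zero hm
  set H := MvPolynomial.homogeneousComponent m L with hH
  have hHdeg : H.totalDegree ≤ m := totalDegree_homogeneousComponent_le m L
  have hHa : H.coeff (Finsupp.single 0 m) ≠ 0 := by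
    rwa [hH, coeff_single_homogeneousComponent]
  obtain ⟨Φ, hΦ⟩ := exists_strictMono_roots hL
  have hsmooth : ∀ j ξ, ξ ≠ 0 → ContDiffAt ℝ ∞ (Φ j) ξ := fun j ξ hξ =>
    contDiffAt_of_strictMono_roots ha hΦ hξ j
  let φ : Fin m → USphere (n + 1) → ℝ := fun j η => Φ j η
  have hφsmooth : ∀ j, ContMDiff (𝓡 n) 𝓘(ℝ, ℝ) ∞ (φ j) := fun j => contMDiff_comp_coe (hsmooth j)
  have hroot : ∀ j ξ, ξ ≠ 0 → (polyAt H ξ).eval (Φ j ξ : ℂ) = 0 := fun j ξ hξ => by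
    rw [eval_polyAt_eq_prod hHdeg hHa (hΦ ξ hξ).2, Finset.prod_eq_zero (Finset.mem_univ j)
      (sub_self _), mul_zero]
  have hD : ∀ ξ, ξ ≠ 0 → ∀ w, (polyAt H ξ).eval w = 0 → (polyAt (tauDeriv H) ξ).eval w ≠ 0 :=
    fun ξ hξ w hw => eval_tauDeriv_ne_zero hHdeg hHa
      (Complex.ofReal_injective.comp (hΦ ξ hξ).1.injective) (hΦ ξ hξ).2 hw
  have hcsmooth : ∀ j, ∀ f ∈ fractionSubalgebra (tauDeriv H) (fun η => (φ j η : ℂ)),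
      ContMDiff (𝓡 n) 𝓘(ℝ, ℂ) ∞ f := fun j f hf =>
    contMDiff_of_mem_fractionSubalgebra (hsmooth j)
      (fun ξ hξ => hD ξ hξ _ (hroot j ξ hξ)) hf
  have hbdd : ∀ j, ∀ f ∈ fractionSubalgebra (tauDeriv H) (fun η => (φ j η : ℂ)),
      ∃ C : ℝ, ∀ η, ‖f η‖ ≤ C := fun j f hf => by
    obtain ⟨C, hC⟩ := isCompact_univ.exists_bound_of_continuousOn
      (hcsmooth j f hf).continuous.continuousOn
    exact ⟨C, fun η => hC η trivial⟩
  choose c hc hsmall using fun j => exists_expansion_coeff hdeg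
    (φ := fun η => (φ j η : ℂ)) (fun η => hroot j η η.ne_zero)
    (fun η => hD η η.ne_zero _ (hroot j η η.ne_zero)) (hbdd j)
  obtain ⟨δ, hδ, hsep⟩ := exists_uniform_separation (fun j => (hφsmooth j).continuous)
    fun η => (hΦ η η.ne_zero).1.injective
  have ha' : 0 < ‖L.coeff (Finsupp.single 0 m)‖ := norm_pos_iff.mpr ha
  choose C₀ hC₀ using fun j => hsmall j 0
  set M := ‖L.coeff (Finsupp.single 0 m)‖ * (δ / 4) ^ m with hM
  have hM0 : 0 < M := by positivity
  -- From this radius on, `L` is small enough at all `r φ_j(η)` for `exists_labelling`.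
  let R := 1 + ∑ j, |C₀ j| / M
  have hR1 : 1 ≤ R := le_add_of_nonneg_right (Finset.sum_nonneg fun j _ => by positivity)
  have hlab : ∀ ξ : Freq (n + 1), ∃ t : Fin m → ℂ,
      (polyAt L ξ).roots = Finset.univ.val.map t ∧
      ∀ (r : ℝ) (η : USphere (n + 1)), R ≤ r → ξ = r • (η : Freq (n + 1)) →
        ∀ j, ‖t j - (r : ℂ) * φ j η‖ ≤ δ / 4 * r := fun ξ => by
    by_cases hξ : ∃ (r : ℝ) (η : USphere (n + 1)), R ≤ r ∧ ξ = r • (η : Freq (n + 1))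
    · obtain ⟨r, η, hr, rfl⟩ := hξ
      have hr0 : 0 < r := by linarith
      obtain ⟨t, ht, hclose⟩ := exists_labelling (ξ := r • (η : Freq (n + 1)))
        (φ := fun j => φ j η) hdeg ha hδ hr0 (fun i j hij => hsep i j hij η) (fun j => by
          have h1 := hC₀ j r (hR1.trans hr) η
          simp only [Finset.range_zero, Finset.sum_empty, add_zero, zero_add, pow_one] at h1
          have h2 : C₀ j < M * r := by
            rw [← div_lt_iff₀' hM0]
            calc C₀ j / M ≤ |C₀ j| / M := by gcongr; exact le_abs_self _
              _ ≤ ∑ j, |C₀ j| / M := Finset.single_le_sum (f := fun j => |C₀ j| / M)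
                (fun j _ => by positivity) (Finset.mem_univ j)
              _ < R := lt_one_add _
              _ ≤ r := hr
          have h3 : C₀ j * r ^ m < M * r * r ^ m := by gcongr
          rw [mul_pow, ← mul_assoc, ← hM]
          refine lt_of_mul_lt_mul_right ?_ hr0.le
          linarith)
      -- The polar coordinates of a frequency `ξ ≠ 0` are unique.
      refine ⟨t, ht, fun r' η' hr' heq => ?_⟩
      have hnorm : ∀ (s : ℝ) (ζ : USphere (n + 1)), R ≤ s → ‖s • (ζ : Freq (n + 1))‖ = s :=
        fun s ζ hs => by
          rw [norm_smul, norm_eq_of_mem_sphere, mul_one, Real.norm_of_nonneg (by linarith)]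
      have hrr : r = r' := by rw [← hnorm r η hr, heq, hnorm r' η' hr']
      subst hrr
      have hηη : η = η' := Subtype.ext (smul_right_injective _ hr0.ne' heq)
      subst hηη
      exact hclose
    · obtain ⟨t, ht⟩ := exists_roots_eq_map hdeg (fun _ => ha) ξ
      exact ⟨t, ht, fun r η hr heq => absurd ⟨r, η, hr, heq⟩ hξ⟩
  choose τ hτ hclose using hlab
  refine ⟨φ, fun j ξ => τ ξ j, c, ⟨fun η => (hΦ η η.ne_zero).2, hτ, fun j K => ?_⟩, hφsmooth,
    fun j k => hcsmooth j _ (hc j k), fun j k =>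
      isAlgebraicFun_of_mem_fractionSubalgebra hHdeg hHa (fun η => hroot j η η.ne_zero)
        (fun η => hD η η.ne_zero) (hc j k)⟩
  exact norm_root_sub_le hdeg ha hδ hsep hτ (fun r hr η j => hclose _ r η hr rfl j)
    (fun k => hbdd j _ (hc j k)) j K (hsmall j K)

end HyperbolicRoots

theorem mainTheorem11 (n m : ℕ) (L : MvPolynomial (Fin ((n + 1) + 1)) ℂ)
    (hL : HyperbolicRoots.IsStrictlyHyperbolic m L)
    (d : WithBot ℕ)
    (hd : HyperbolicRoots.totalDeg (L - MvPolynomial.homogeneousComponent m L) = d)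
    (hdm : d + 1 < (m : WithBot ℕ)) :
    (∃ (φ : Fin m → HyperbolicRoots.USphere (n + 1) → ℝ)
      (τ : Fin m → HyperbolicRoots.Freq (n + 1) → ℂ)
      (c : Fin m → ℕ → HyperbolicRoots.USphere (n + 1) → ℂ),
      HyperbolicRoots.IsRootExpansion m L φ τ c ∧
      (∀ j, ContMDiff (𝓡 n) 𝓘(ℝ, ℝ) ∞ (φ j)) ∧
      (∀ j k, ContMDiff (𝓡 n) 𝓘(ℝ, ℂ) ∞ (c j k)) ∧
      (∀ j k, HyperbolicRoots.IsAlgebraicFun (c j k))) ∧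
    (∀ (φ : Fin m → HyperbolicRoots.USphere (n + 1) → ℝ)
      (τ : Fin m → HyperbolicRoots.Freq (n + 1) → ℂ)
      (c : Fin m → ℕ → HyperbolicRoots.USphere (n + 1) → ℂ),
      HyperbolicRoots.IsRootExpansion m L φ τ c →
      ∀ (j : Fin m) (k : ℕ), d + ((k + 2 : ℕ) : WithBot ℕ) ≤ (m : WithBot ℕ) →
        ∀ η : HyperbolicRoots.USphere (n + 1), c j k η = 0) := by
  subst hd
  refine ⟨?_, fun φ τ c h j k hk η => h.coeff_eq_zero hL j η k hk⟩
  by_cases hm : m = 0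
  · -- There is nothing to expand when there are no roots.
    subst hm
    have hroots : ∀ ξ, (HyperbolicRoots.polyAt L ξ).roots = 0 := fun ξ =>
      Multiset.card_eq_zero.mp
        (HyperbolicRoots.card_roots_polyAt hL.1.le (fun h => absurd rfl h) ξ)
    refine ⟨fun j => j.elim0, fun j => j.elim0, fun j => j.elim0,
      ⟨fun η => ?_, fun ξ => ?_, fun j => j.elim0⟩, fun j => j.elim0, fun j => j.elim0,
      fun j => j.elim0⟩
    · obtain ⟨φ, -, h⟩ := hL.2 η η.ne_zero
      rw [h]
      rfl
    · rw [hroots]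
      rfl
  · exact hL.exists_isRootExpansion hm
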